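/- Let $\mathbb K=\mathbb R$ or $\mathbb C$, let $A^\dagger$ denote the conjugate transpose of $A$ (the transpose if $\mathbb K=\mathbb R$), and let $H\in\mathbb K^{n\times n}$ be nonsingular with $H^\dagger=H$. Put $[x,y]_H=x^\dagger Hy$ and, for a nonsingular selfadjoint $N$, $A^{[N]}=N^{-1}A^\dagger N$. A matrix $L$ is $H$-unitary if $L^{[H]}L=LL^{[H]}=I_n$; $S$ is $N$-selfadjoint if $S^{[N]}=S$; $A$ is $H$-normal if $AA^{[H]}=A^{[H]}A$; $X$ is $H$-neutral involutory if $X^2=I_n$ and $[u,v]_H=0$ for all $u,v$ with $Xu=-u$, $Xv=-v$. A matrix is $r$-positive-definite if all its complex eigenvalues have positive real part. For a nonsingular matrix $A$ without negative real eigenvalues, $A^{1/2}$ is the unique $r$-positive-definite complex solution $S$ of $S^2=A$. For a nonsingular matrix $A$, $\mathrm{Sign}(A)$ is the primary matrix function of $A$ (Hermite interpolation on the spectrum) with the stem function equal to $-1$ at negative real $\lambda$ and $+1$ at all other $\lambda\neq0$, all derivatives being $0$. Let $F\in\mathbb K^{n\times n}$ be nonsingular, $\Sigma=\mathrm{Sign}(F^{[H]}F)$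 and $\Sigma'=\mathrm{Sign}(FF^{[H]})$. Then $\Sigma,\Sigma'\in\mathbb K^{n\times n}$; the matrix $S=(\Sigma F^{[H]}F)^{1/2}$ exists, lies in $\mathbb K^{n\times n}$ and is $r$-positive-definite, $H$-selfadjoint and $H\Sigma$-selfadjoint; the matrix $S'=(\Sigma' FF^{[H]})^{1/2}$ exists, lies in $\mathbb K^{n\times n}$ and is $r$-positive-definite, $H$-selfadjoint and $H\Sigma'$-selfadjoint; and $F$ can be factorized as $$F=LXS=S'L_1X_1=S'X'L'=X_1'L_1'S$$ where $L,L_1,L',L_1'\in\mathbb K^{n\times n}$ are $H$-unitary, $X,X_1,X',X_1'\in\mathbb K^{n\times n}$ are $H$-normal $H$-neutral involutory, and $LX=L_1X_1=X'L'=X_1'L_1'$. The factorization is in general not unique: if $\Sigma\ne I_n$, then for every choice of the eight matrices $L,X,L_1,X_1,X',L',X_1',L_1'$ as above there is another such choice (with the same $S$, $S'$) in which each of the eight matrices is different. -/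

import Mathlib

/-! Basic notions of the indefinite inner product space defined by a nonsingular selfadjoint
matrix over the real or complex field. Conjugate transposition on a real field is transposition. -/

section IndefiniteInnerProduct

variable {K : Type*} [RCLike K] {n : Type*} [Fintype n] [DecidableEq n]

/-- The inner product of `x` and `y` defined by the matrix `H`, conjugate linear in `x`. -/
def hInner (H : Matrix n n K) (x y : n → K) : K :=
  dotProduct (star x) (H.mulVec y)

/-- The adjoint of `A` with respect to a nonsingular `H`. -/
noncomputable def hAdjoint (H A : Matrix n n K) : Matrix n n K :=
  H⁻¹ * A.conjTranspose * H

/-- `L` is unitary with respect to `H`. -/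
def IsHUnitary (H L : Matrix n n K) : Prop :=
  hAdjoint H L * L = 1 ∧ L * hAdjoint H L = 1

/-- `S` is selfadjoint with respect to `H`. -/
def IsHSelfadjoint (H S : Matrix n n K) : Prop :=
  hAdjoint H S = S

/-- `A` is normal with respect to `H`. -/
def IsHNormal (H A : Matrix n n K) : Prop :=
  A * hAdjoint H A = hAdjoint H A * A

/-- `X` is an involution whose negative eigenspace is neutral for the inner product of `H`. -/
def IsHNeutralInvolutory (H X : Matrix n n K) : Prop :=
  X * X = 1 ∧ ∀ u v : n → K, X.mulVec u = -u → X.mulVec v = -v → hInner H u v = 0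

/-- `X` is an `H`-normal `H`-neutral involution. -/
def IsHNormalNeutralInvolutory (H X : Matrix n n K) : Prop :=
  IsHNeutralInvolutory H X ∧ IsHNormal H X

/-- The matrix `A` with its entries regarded as complex numbers. -/
noncomputable def complexify (A : Matrix n n K) : Matrix n n ℂ :=
  A.map (RCLike.map K ℂ)

/-- All (complex) eigenvalues of `A` have positive real part. -/
def IsRPosDef (A : Matrix n n K) : Prop :=
  ∀ z ∈ spectrum ℂ (complexify A), 0 < z.re

/-- `S` is the principal square root of `A`: the matrix `A` is nonsingular without negative real
eigenvalues (its spectrum lies in the slit plane), and `S` is the unique complex matrix with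
square `A` all of whose eigenvalues have positive real part. -/
def IsPrincipalSqrt (A S : Matrix n n K) : Prop :=
  spectrum ℂ (complexify A) ⊆ Complex.slitPlane ∧
  IsRPosDef S ∧ S * S = A ∧
  ∀ T : Matrix n n ℂ, IsRPosDef T → T * T = complexify A → T = complexify S

/-- `B` is the primary matrix function of the complex matrix `A` associated with the stem function
given by the values `f 0 z` and the derivatives `f j z` (`1 ≤ j`) at the points `z` of the
domain `D`: the stem function is defined on the spectrum of `A`, and `B = p(A)` for a polynomial
`p` which interpolates it at each eigenvalue `z`, with as many derivatives as the multiplicity of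
`z` in the minimal polynomial of `A` (the size of the largest Jordan block at `z`) requires. -/
def IsPrimaryFunction (D : Set ℂ) (f : ℕ → ℂ → ℂ) (A B : Matrix n n ℂ) : Prop :=
  spectrum ℂ A ⊆ D ∧
  ∃ p : Polynomial ℂ,
    (∀ z ∈ spectrum ℂ A, ∀ j < (minpoly ℂ A).rootMultiplicity z,
      (Polynomial.derivative^[j] p).eval z = f j z) ∧
    B = Polynomial.aeval A p

open Classical in
/-- The stem function of the matrix sign function: it is `-1` on the negative real axis and `1` at
all other nonzero points, and all its derivatives vanish. (It is undefined at zero.) -/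
noncomputable def signStem (j : ℕ) (z : ℂ) : ℂ :=
  if j = 0 then (if z.re < 0 ∧ z.im = 0 then -1 else 1) else 0

/-- The matrix `T` over `K` is `Sign(A)`. -/
def IsMatrixSign (A T : Matrix n n K) : Prop :=
  IsPrimaryFunction {0}ᶜ signStem (complexify A) (complexify T)

/-- The values of a primary matrix function are unique. -/
theorem IsPrimaryFunction.unique {D : Set ℂ} {f : ℕ → ℂ → ℂ} {A B C : Matrix n n ℂ}
    (hB : IsPrimaryFunction D f A B) (hC : IsPrimaryFunction D f A C) : B = C := by
  obtain ⟨-, p, hp, rfl⟩ := hB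
  obtain ⟨-, q, hq, rfl⟩ := hC
  have hm : minpoly ℂ A ≠ 0 := minpoly.ne_zero (Matrix.isIntegral A)
  have hdvd : minpoly ℂ A ∣ p - q := by
    by_cases h0 : p - q = 0
    · simp [h0]
    refine (IsAlgClosed.splits (minpoly ℂ A)).dvd_of_roots_le_roots hm ?_
    rw [Multiset.le_iff_count]
    intro z
    rw [Polynomial.count_roots, Polynomial.count_roots]
    by_contra hlt
    push Not at hlt
    have hz : z ∈ spectrum ℂ A := by
      have hr : (minpoly ℂ A).IsRoot z :=
        (Polynomial.rootMultiplicity_pos hm).1 (lt_of_le_of_lt (Nat.zero_le _) hlt)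
      rw [← Matrix.spectrum_toLin', ← Module.End.hasEigenvalue_iff_mem_spectrum,
        Module.End.hasEigenvalue_iff_isRoot, Matrix.minpoly_toLin']
      exact hr
    refine lt_irrefl _ (Polynomial.lt_rootMultiplicity_of_isRoot_iterate_derivative h0
      (n := (p - q).rootMultiplicity z) (t := z) ?_)
    intro j hj
    have h1 := hp z hz j (lt_of_le_of_lt hj hlt)
    have h2 := hq z hz j (lt_of_le_of_lt hj hlt)
    simp [Polynomial.IsRoot, h1, h2]
  have := (minpoly.dvd_iff (A := ℂ) (x := A)).1 hdvd
  rwa [map_sub, sub_eq_zero] at this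

theorem complexify_injective :
    Function.Injective (complexify : Matrix n n K → Matrix n n ℂ) := by
  intro A B h
  ext i j
  have h1 : RCLike.map K ℂ (A i j) = RCLike.map K ℂ (B i j) := congrFun (congrFun h i) j
  have h2 := congrArg Complex.re h1
  have h3 := congrArg Complex.im h1
  apply RCLike.ext
  · simpa using h2
  · simpa using h3

/-- `Sign(A)` is unique. -/
theorem IsMatrixSign.unique {A T U : Matrix n n K}
    (hT : IsMatrixSign A T) (hU : IsMatrixSign A U) : T = U :=
  complexify_injective (IsPrimaryFunction.unique hT hU)

/-- The four factorizations of `F` with given factors `S`, `S'` into matrices normal with respect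
to `H`. -/
structure IsNormalFactorization
    (H F S S' L X L₁ X₁ X' L' X₁' L₁' : Matrix n n K) : Prop where
  eq_LXS : F = L * X * S
  eq_SLX : F = S' * L₁ * X₁
  eq_SXL : F = S' * X' * L'
  eq_XLS : F = X₁' * L₁' * S
  unitary_L : IsHUnitary H L
  unitary_L₁ : IsHUnitary H L₁
  unitary_L' : IsHUnitary H L'
  unitary_L₁' : IsHUnitary H L₁'
  neutral_X : IsHNormalNeutralInvolutory H X
  neutral_X₁ : IsHNormalNeutralInvolutory H X₁
  neutral_X' : IsHNormalNeutralInvolutory H X'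
  neutral_X₁' : IsHNormalNeutralInvolutory H X₁'
  eq_LX : L * X = L₁ * X₁
  eq_LX' : L₁ * X₁ = X' * L'
  eq_XL : X' * L' = X₁' * L₁'

end IndefiniteInnerProduct

/-!
The matrices `A = F^[H] F` and `A' = F F^[H]` satisfy `F A = A' F`, and both are annihilated by the
minimal polynomial `f` of `A` over `ℝ`, which does not vanish at zero. Newton's iteration in
`ℝ[X] / (f)` (`exists_sq_sub_dvd`) lifts suitable values at the complex roots of `f` to real
polynomials `p`, `q` with `p² ≡ 1` and `q² ≡ p X` modulo `f`, such that `p` is the sign function and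
`q` has positive real part at the roots. Then `Σ = p(A)`, `S = q(A)`, `Σ' = p(A')`, `S' = q(A')`
(`exists_polynomials_isMatrixSign_isPrincipalSqrt`). Since `p` and `q` are real, these matrices have
entries in `K` and are `H`-selfadjoint, and `F S = S' F`. Uniqueness of the square root is the fact
that the Sylvester equation `T Y = -Y S` has only the zero solution when the eigenvalues of `S` and
`T` lie in the open right half-plane.

The matrix `W = F S⁻¹ = S'⁻¹ F` satisfies `W^[H] W = Σ`, and it remains to write it as `L X` and as
`X' L'`. If `X` is `H`-normal and neutral involutory with `X^[H] X = Σ`, then `L = W X` is unitary, and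
`X' = L X L^[H]`, `L' = L` give the opposite order. Such an `X` exists
(`exists_neutral_involution_of_hAdjoint_mul_self`) because `H Σ = Wᴴ H W` is congruent to `H`: by the
law of inertia, `H` has as many positive as negative squares on the negative eigenspace of `Σ`, and in
a basis which diagonalizes both forms `X` exchanges positive and negative basis vectors there, and
fixes the others.

Neutrality of an involution `X` means `(1 - X^[H]) (1 - X) = 0` (`isHNeutralInvolutory_iff`), which for
`H`-normal `X` is symmetric in `X` and `X^[H]`. Therefore `L X = (L X X^[H]) X^[H]` is another
factorization of the same kind, and both factors differ from the old ones unless `X X^[H] = 1`,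
which would make `W` unitary and `Σ = 1`.
-/

/-! ### Real polynomials modulo a polynomial -/

open Polynomial ComplexConjugate in
/-- The witness is the polynomial of the real parts of the coefficients. -/
theorem exists_real_polynomial_two_mul_aeval_eq (q : ℂ[X]) :
    ∃ p : ℝ[X], ∀ z : ℂ, 2 * aeval z p = q.eval z + conj (q.eval (conj z)) := by
  induction q using Polynomial.induction_on' with
  | add q r hq hr =>
    obtain ⟨p₁, h₁⟩ := hq
    obtain ⟨p₂, h₂⟩ := hr
    refine ⟨p₁ + p₂, fun z => ?_⟩
    rw [map_add, mul_add, h₁, h₂]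
    simp only [eval_add, map_add]
    ring
  | monomial k a =>
    refine ⟨monomial k a.re, fun z => ?_⟩
    have h := Complex.add_conj a
    simp only [aeval_monomial, eval_monomial, map_mul, map_pow, Complex.conj_conj]
    rw [← add_mul, h, ← mul_assoc]
    push_cast
    rfl

open Polynomial ComplexConjugate in
/-- Interpolation by real polynomials at a finite set of complex nodes stable under conjugation. -/
theorem exists_real_polynomial_interpolating (s : Finset ℂ) (hs : ∀ z ∈ s, conj z ∈ s) (g : ℂ → ℂ)
    (hg : ∀ z ∈ s, g (conj z) = conj (g z)) :
    ∃ p : ℝ[X], ∀ z ∈ s, aeval z p = g z := by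
  obtain ⟨p, hp⟩ := exists_real_polynomial_two_mul_aeval_eq (Lagrange.interpolate s id g)
  refine ⟨p, fun z hz => ?_⟩
  have h := hp z
  have e : ∀ w ∈ s, (Lagrange.interpolate s id g).eval w = g w := fun w hw =>
    Lagrange.eval_interpolate_at_node (v := id) g (Set.injOn_id _) hw
  rw [e z hz, e _ (hs z hz), hg z hz, Complex.conj_conj, ← two_mul] at h
  exact mul_left_cancel₀ two_ne_zero h

open Polynomial in
theorem dvd_pow_of_forall_aeval_eq_zero {f h : ℝ[X]} (hf : f ≠ 0)
    (hfh : ∀ z : ℂ, aeval z f = 0 → aeval z h = 0) : ∃ N : ℕ, f ∣ h ^ N := by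
  refine ⟨f.natDegree + 1, ?_⟩
  rcases eq_or_ne h 0 with rfl | hh
  · simp
  rw [← map_dvd_map' (algebraMap ℝ ℂ)]
  have hf' : f.map (algebraMap ℝ ℂ) ≠ 0 :=
    (Polynomial.map_ne_zero_iff (algebraMap ℝ ℂ).injective).2 hf
  have hh' : h.map (algebraMap ℝ ℂ) ≠ 0 :=
    (Polynomial.map_ne_zero_iff (algebraMap ℝ ℂ).injective).2 hh
  refine (IsAlgClosed.splits _).dvd_of_roots_le_roots hf' ?_
  rw [Polynomial.map_pow, roots_pow, Multiset.le_iff_count]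
  intro z
  rw [Multiset.count_nsmul]
  by_cases hz : z ∈ (f.map (algebraMap ℝ ℂ)).roots
  · have h1 : aeval z f = 0 := by
      rw [mem_roots hf', IsRoot, eval_map_algebraMap] at hz
      exact hz
    have h2 : 1 ≤ Multiset.count z (h.map (algebraMap ℝ ℂ)).roots := by
      rw [Multiset.one_le_count_iff_mem, mem_roots hh', IsRoot, eval_map_algebraMap]
      exact hfh z h1
    calc _ ≤ (f.map (algebraMap ℝ ℂ)).roots.card := Multiset.count_le_card _ _
      _ ≤ (f.map (algebraMap ℝ ℂ)).natDegree := card_roots' _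
      _ ≤ f.natDegree + 1 := by rw [natDegree_map]; exact Nat.le_succ _
      _ ≤ _ := Nat.le_mul_of_pos_right _ h2
  · rw [Multiset.count_eq_zero_of_notMem hz]
    exact Nat.zero_le _

open Polynomial ComplexConjugate in
/-- A square root of `c` modulo `f` with prescribed values at the complex roots of `f`: an
interpolating polynomial is a square root of `c` up to a nilpotent error, which Newton's iteration
in `ℝ[X] / (f)` removes. -/
theorem exists_sq_sub_dvd {f : ℝ[X]} (hf : f ≠ 0) (c : ℝ[X]) (g : ℂ → ℂ)
    (hconj : ∀ z, aeval z f = 0 → g (conj z) = conj (g z))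
    (hsq : ∀ z, aeval z f = 0 → g z ^ 2 = aeval z c)
    (hne : ∀ z, aeval z f = 0 → g z ≠ 0) :
    ∃ p : ℝ[X], f ∣ p ^ 2 - c ∧ ∀ z : ℂ, aeval z f = 0 → aeval z p = g z := by
  have hf' : f.map (algebraMap ℝ ℂ) ≠ 0 :=
    (Polynomial.map_ne_zero_iff (algebraMap ℝ ℂ).injective).2 hf
  have hmem : ∀ z, z ∈ (f.map (algebraMap ℝ ℂ)).roots.toFinset ↔ aeval z f = 0 := by
    intro z
    rw [Multiset.mem_toFinset, mem_roots hf', IsRoot, eval_map_algebraMap]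
  obtain ⟨q, hq⟩ := exists_real_polynomial_interpolating (f.map (algebraMap ℝ ℂ)).roots.toFinset
    (fun z hz => by rw [hmem] at hz ⊢; rw [aeval_conj, hz, map_zero]) g
    (fun z hz => hconj z ((hmem z).1 hz))
  simp only [hmem] at hq
  let x : AdjoinRoot f := AdjoinRoot.mk f q
  let P : (AdjoinRoot f)[X] := X ^ 2 - C (AdjoinRoot.mk f c)
  have hnil : IsNilpotent (aeval x P) := by
    obtain ⟨N, hN⟩ := dvd_pow_of_forall_aeval_eq_zero (h := q ^ 2 - c) hf (fun z hz => by
      rw [map_sub, map_pow, hq z hz, hsq z hz, sub_self])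
    refine ⟨N, ?_⟩
    rw [← AdjoinRoot.mk_eq_zero, map_pow, map_sub, map_pow] at hN
    simpa [P, x] using hN
  have hunit : IsUnit (aeval x (derivative P)) := by
    have hcop : IsCoprime f (2 * q) := by
      refine (isCoprime_iff_aeval_ne_zero_of_isAlgClosed ℝ ℂ f (2 * q)).2 fun z => ?_
      by_cases hz : aeval z f = 0
      · right
        rw [map_mul, hq z hz, map_ofNat]
        exact mul_ne_zero two_ne_zero (hne z hz)
      · exact Or.inl hz
    obtain ⟨a, b, hab⟩ := hcop
    have h1 := congrArg (AdjoinRoot.mk f) hab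
    rw [map_add, map_mul, AdjoinRoot.mk_self, mul_zero, zero_add, map_mul, map_one] at h1
    have h2 : aeval x (derivative P) = AdjoinRoot.mk f (2 * q) := by
      rw [map_mul, map_ofNat]
      simp [P, x, one_add_one_eq_two]
    rw [h2]
    exact IsUnit.of_mul_eq_one_right _ h1
  obtain ⟨r, ⟨hr1, hr2⟩, -⟩ := existsUnique_nilpotent_sub_and_aeval_eq_zero hnil hunit
  obtain ⟨p, rfl⟩ := AdjoinRoot.mk_surjective r
  refine ⟨p, ?_, fun z hz => ?_⟩
  · rw [← AdjoinRoot.mk_eq_zero, map_sub, map_pow]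
    simpa [P] using hr2
  · obtain ⟨N, hN⟩ := hr1
    rw [← map_sub, ← map_pow, AdjoinRoot.mk_eq_zero] at hN
    obtain ⟨k, hk⟩ := hN
    have h := congrArg (aeval z) hk
    rw [map_mul, hz, zero_mul, map_pow] at h
    replace h := pow_eq_zero_iff (n := N) (by rintro rfl; simp at h) |>.1 h
    rw [map_sub, hq z hz, sub_eq_zero] at h
    exact h.symm

/-! ### The sign stem function and complex square roots -/

open ComplexConjugate in
theorem signStem_zero_conj (z : ℂ) : signStem 0 (conj z) = conj (signStem 0 z) := by
  unfold signStem
  simp only [if_true, Complex.conj_re, Complex.conj_im, neg_eq_zero]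
  split_ifs <;> simp

theorem signStem_zero_sq (z : ℂ) : signStem 0 z ^ 2 = 1 := by
  unfold signStem
  simp only [if_true]
  split_ifs <;> simp

theorem signStem_zero_mul_mem_slitPlane {z : ℂ} (hz : z ≠ 0) :
    signStem 0 z * z ∈ Complex.slitPlane := by
  unfold signStem
  rw [Complex.mem_slitPlane_iff]
  simp only [if_true]
  split_ifs with h
  · left
    simpa using h.1
  · rw [one_mul]
    by_contra! hc
    have : z.re ≠ 0 := fun h0 => hz (Complex.ext h0 hc.2)
    exact h ⟨lt_of_le_of_ne hc.1 this, hc.2⟩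

theorem re_cpow_inv_two_pos {w : ℂ} (hw : w ∈ Complex.slitPlane) :
    0 < (w ^ (2⁻¹ : ℂ)).re := by
  have hw' := Complex.mem_slitPlane_iff_arg.1 hw
  rw [Complex.cpow_def_of_ne_zero hw'.2, Complex.exp_re]
  refine mul_pos (Real.exp_pos _) (Real.cos_pos_of_mem_Ioo ?_)
  have h1 : (Complex.log w * 2⁻¹).im = w.arg / 2 := by
    rw [show (2⁻¹ : ℂ) = ((2⁻¹ : ℝ) : ℂ) by push_cast; rfl, Complex.im_mul_ofReal, Complex.log_im]
    ring
  rw [h1]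
  have h2 := Complex.neg_pi_lt_arg w
  have h3 := lt_of_le_of_ne (Complex.arg_le_pi w) hw'.1
  constructor <;> linarith

open ComplexConjugate in
theorem conj_cpow_inv_two {w : ℂ} (hw : w ∈ Complex.slitPlane) :
    conj w ^ (2⁻¹ : ℂ) = conj (w ^ (2⁻¹ : ℂ)) := by
  rw [Complex.conj_cpow _ _ (Complex.mem_slitPlane_iff_arg.1 hw).1, map_inv₀, Complex.conj_ofNat]

open Polynomial in
/-- Real polynomials which, modulo `f`, represent the matrix sign function and the principal square
root of `Sign(A) A`. -/
theorem exists_sign_sqrt_polynomials {f : ℝ[X]} (hf : f ≠ 0)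
    (hf0 : ∀ z : ℂ, aeval z f = 0 → z ≠ 0) :
    ∃ p q : ℝ[X], f ∣ p ^ 2 - 1 ∧ (∀ z : ℂ, aeval z f = 0 → aeval z p = signStem 0 z) ∧
      f ∣ q ^ 2 - p * X ∧ ∀ z : ℂ, aeval z f = 0 → 0 < (aeval z q).re := by
  obtain ⟨p, hp, hpz⟩ := exists_sq_sub_dvd hf 1 (signStem 0) (fun z _ => signStem_zero_conj z)
    (fun z _ => by rw [signStem_zero_sq, map_one])
    (fun z _ h => by simpa [h] using signStem_zero_sq z)
  obtain ⟨q, hq, hqz⟩ := exists_sq_sub_dvd hf (p * X) (fun z => (signStem 0 z * z) ^ (2⁻¹ : ℂ))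
    (fun z hz => by
      rw [← conj_cpow_inv_two (signStem_zero_mul_mem_slitPlane (hf0 z hz)), map_mul,
        signStem_zero_conj])
    (fun z hz => by
      rw [Complex.cpow_ofNat_inv_pow, map_mul, aeval_X, hpz z hz])
    (fun z hz h => by
      have := re_cpow_inv_two_pos (signStem_zero_mul_mem_slitPlane (hf0 z hz))
      rw [h] at this
      exact lt_irrefl _ this)
  refine ⟨p, q, hp, hpz, hq, fun z hz => ?_⟩
  rw [hqz z hz]
  exact re_cpow_inv_two_pos (signStem_zero_mul_mem_slitPlane (hf0 z hz))

/-! ### Matrix functions given by real polynomials -/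

/-- The embedding of `K` into the complex numbers, as a homomorphism of real algebras. -/
noncomputable def RCLike.toComplexAlgHom (K : Type*) [RCLike K] : K →ₐ[ℝ] ℂ :=
  AlgHom.ofLinearMap (RCLike.map K ℂ).toLinearMap
    (by apply Complex.ext <;> simp) (fun a b => by
      apply Complex.ext <;> simp [RCLike.mul_re, RCLike.mul_im])

section MatrixFunctions

variable {K : Type*} [RCLike K] {n : Type*} [Fintype n] [DecidableEq n]

/-- `complexify` as a homomorphism of real algebras. -/
noncomputable def complexifyAlgHom (K n : Type*) [RCLike K] [Fintype n] [DecidableEq n] :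
    Matrix n n K →ₐ[ℝ] Matrix n n ℂ :=
  (RCLike.toComplexAlgHom K).mapMatrix

theorem complexifyAlgHom_apply (A : Matrix n n K) : complexifyAlgHom K n A = complexify A := rfl

open Polynomial

theorem complexify_aeval (A : Matrix n n K) (p : ℝ[X]) :
    complexify (aeval A p) = aeval (complexify A) (p.map (algebraMap ℝ ℂ)) := by
  rw [aeval_map_algebraMap, ← complexifyAlgHom_apply, ← complexifyAlgHom_apply, aeval_algHom_apply]

/-- Spectral mapping for real polynomials in a matrix over `K`. -/
theorem exists_of_mem_spectrum_complexify_aeval {A : Matrix n n K} {p : ℝ[X]} {w : ℂ}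
    (hw : w ∈ spectrum ℂ (complexify (aeval A p))) :
    ∃ z ∈ spectrum ℂ (complexify A), aeval z p = w := by
  rw [complexify_aeval] at hw
  have : Nontrivial (Matrix n n ℂ) := by
    by_contra h
    rw [not_nontrivial_iff_subsingleton] at h
    rw [spectrum.of_subsingleton] at hw
    exact hw
  rw [spectrum.map_polynomial_aeval_of_nonempty _ _
    (spectrum.nonempty_of_isAlgClosed_of_finiteDimensional ℂ (complexify A))] at hw
  obtain ⟨z, hz, h⟩ := hw
  exact ⟨z, hz, by rw [← eval_map_algebraMap]; exact h⟩

theorem aeval_eq_zero_of_mem_spectrum_complexify {A : Matrix n n K} {f : ℝ[X]} (hf : aeval A f = 0)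
    {z : ℂ} (hz : z ∈ spectrum ℂ (complexify A)) : aeval z f = 0 := by
  have : Nontrivial (Matrix n n ℂ) := by
    by_contra h
    rw [not_nontrivial_iff_subsingleton] at h
    rw [spectrum.of_subsingleton] at hz
    exact hz
  have h := spectrum.subset_polynomial_aeval (complexify A) (f.map (algebraMap ℝ ℂ)) ⟨z, hz, rfl⟩
  rw [← complexify_aeval, hf, ← complexifyAlgHom_apply, map_zero, spectrum.zero_eq] at h
  simpa [eval_map_algebraMap] using h

/-- A solution `X` of `T X = -X S` vanishes if the eigenvalues of `S` and `T` have positive real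
parts: `T` and `-S` have no eigenvalue in common. -/
theorem eq_zero_of_mul_eq_neg_mul {S T Y : Matrix n n ℂ}
    (hS : ∀ z ∈ spectrum ℂ S, 0 < z.re) (hT : ∀ z ∈ spectrum ℂ T, 0 < z.re)
    (h : T * Y = Y * -S) : Y = 0 := by
  have key : ∀ p : ℂ[X], aeval T p * Y = Y * aeval (-S) p := by
    intro p
    induction p using Polynomial.induction_on' with
    | add p q hp hq => rw [map_add, map_add, add_mul, mul_add, hp, hq]
    | monomial k a =>
      have hk : T ^ k * Y = Y * (-S) ^ k :=
        (SemiconjBy.pow_right (show SemiconjBy Y (-S) T from h.symm) k).eq.symm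
      rw [aeval_monomial, aeval_monomial, mul_assoc, hk, ← mul_assoc, Algebra.commutes a Y,
        mul_assoc]
  have hp := key (minpoly ℂ (-S))
  rw [minpoly.aeval, mul_zero] at hp
  have hu : IsUnit (aeval T (minpoly ℂ (-S))) := by
    rw [← spectrum.zero_notMem_iff ℂ]
    intro h0
    have : Nontrivial (Matrix n n ℂ) := by
      by_contra hn
      rw [not_nontrivial_iff_subsingleton] at hn
      rw [spectrum.of_subsingleton] at h0
      exact h0
    rw [spectrum.map_polynomial_aeval_of_nonempty _ _
      (spectrum.nonempty_of_isAlgClosed_of_finiteDimensional ℂ T)] at h0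
    obtain ⟨z, hz, hz0⟩ := h0
    have h1 : z ∈ spectrum ℂ (-S) := by
      rw [← Matrix.spectrum_toLin', ← Module.End.hasEigenvalue_iff_mem_spectrum,
        Module.End.hasEigenvalue_iff_isRoot, Matrix.minpoly_toLin']
      exact hz0
    rw [← spectrum.neg_eq, Set.mem_neg] at h1
    have h2 := hS _ h1
    have h3 := hT _ hz
    rw [Complex.neg_re] at h2
    linarith
  exact (hu.mul_right_eq_zero).1 hp

theorem isPrincipalSqrt_of_mul_self {A S : Matrix n n K}
    (hA : spectrum ℂ (complexify A) ⊆ Complex.slitPlane) (hS : IsRPosDef S) (h : S * S = A) :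
    IsPrincipalSqrt A S := by
  refine ⟨hA, hS, h, fun T hT hTA => ?_⟩
  have hT' : ∀ z ∈ spectrum ℂ T, 0 < z.re := by
    have : complexify T = T := by ext i j; simp [complexify]
    rwa [IsRPosDef, this] at hT
  have hSS : complexify S * complexify S = complexify A := by
    rw [← h, ← complexifyAlgHom_apply, ← complexifyAlgHom_apply, map_mul]
  rw [← sub_eq_zero]
  refine eq_zero_of_mul_eq_neg_mul hS hT' ?_
  rw [mul_neg, mul_sub, sub_mul, hTA, hSS]
  abel

/-- A polynomial whose square is `1` modulo an annihilating polynomial and which has the values of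
the sign function on the spectrum satisfies all interpolation conditions: at an eigenvalue only one
of the factors `p - 1` and `p + 1` vanishes, and it vanishes to the full order. -/
theorem isMatrixSign_aeval {A : Matrix n n K} {f p : ℝ[X]} (hf : aeval A f = 0)
    (hA : 0 ∉ spectrum ℂ (complexify A)) (hp : f ∣ p ^ 2 - 1)
    (hpz : ∀ z : ℂ, aeval z f = 0 → aeval z p = signStem 0 z) : IsMatrixSign A (aeval A p) := by
  refine ⟨fun z hz h0 => hA (Set.mem_singleton_iff.1 h0 ▸ hz), p.map (algebraMap ℝ ℂ), ?_,
    complexify_aeval A p⟩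
  intro z hz j hj
  have hz' : eval z (p.map (algebraMap ℝ ℂ)) = signStem 0 z := by
    rw [eval_map_algebraMap]
    exact hpz z (aeval_eq_zero_of_mem_spectrum_complexify hf hz)
  rcases Nat.eq_zero_or_pos j with rfl | hj0
  · exact hz'
  set P : ℂ[X] := p.map (algebraMap ℝ ℂ) with hP
  set s : ℂ := signStem 0 z with hs
  set m := (minpoly ℂ (complexify A)).rootMultiplicity z with hm
  have h1 : (X - C z) ^ m ∣ (P + C s) * (P - C s) := by
    refine (pow_rootMultiplicity_dvd _ _).trans ?_
    have h2 : (P + C s) * (P - C s) = (p ^ 2 - 1).map (algebraMap ℝ ℂ) := by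
      rw [Polynomial.map_sub, Polynomial.map_pow, Polynomial.map_one, ← hP, ← C_1,
        ← signStem_zero_sq z, ← hs, C_pow]
      ring
    rw [h2]
    refine (minpoly.dvd_iff.2 ?_)
    rw [← complexify_aeval, ← complexifyAlgHom_apply]
    obtain ⟨k, hk⟩ := hp
    rw [hk, map_mul, hf, zero_mul, map_zero]
  have hcop : IsCoprime ((X - C z) ^ m) (P + C s) := by
    refine IsCoprime.pow_left ((irreducible_X_sub_C z).coprime_iff_not_dvd.2 ?_)
    rw [dvd_iff_isRoot, IsRoot, eval_add, eval_C, hz', ← two_mul]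
    refine mul_ne_zero two_ne_zero fun h0 => ?_
    have := signStem_zero_sq z
    rw [← hs, h0] at this
    norm_num at this
  have h3 := hcop.dvd_of_dvd_mul_left h1
  have h4 : X - C z ∣ derivative^[j] (P - C s) :=
    (dvd_pow_self _ (Nat.sub_ne_zero_of_lt hj)).trans (pow_sub_dvd_iterate_derivative_of_pow_dvd j h3)
  rw [dvd_iff_isRoot, IsRoot, iterate_derivative_sub, iterate_derivative_C hj0, sub_zero] at h4
  rw [h4, signStem, if_neg hj0.ne']

/-- The sign function and the principal square root of `Sign(A) A` are real polynomials in `A`; the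
same polynomials serve for all nonsingular matrices with a common annihilating polynomial. -/
theorem exists_polynomials_isMatrixSign_isPrincipalSqrt {f : ℝ[X]} (hf0 : f ≠ 0)
    (hf1 : aeval (0 : ℂ) f ≠ 0) :
    ∃ p q : ℝ[X], ∀ A : Matrix n n K, aeval A f = 0 →
      IsMatrixSign A (aeval A p) ∧ aeval A p * aeval A p = 1 ∧
      IsPrincipalSqrt (aeval A p * A) (aeval A q) := by
  have hfz : ∀ z : ℂ, aeval z f = 0 → z ≠ 0 := by rintro _ h rfl; exact hf1 h
  obtain ⟨p, q, hp, hpz, hq, hqz⟩ := exists_sign_sqrt_polynomials hf0 hfz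
  refine ⟨p, q, fun A hA => ⟨isMatrixSign_aeval hA (fun h0 => ?_) hp hpz, ?_, ?_⟩⟩
  · exact hfz _ (aeval_eq_zero_of_mem_spectrum_complexify hA h0) rfl
  · obtain ⟨k, hk⟩ := hp
    have := congrArg (aeval A) hk
    rw [map_mul, hA, zero_mul, map_sub, map_one, sub_eq_zero, map_pow, pow_two] at this
    exact this
  · refine isPrincipalSqrt_of_mul_self (fun w hw => ?_) (fun w hw => ?_) ?_
    · have h : aeval A p * A = aeval A (p * X) := by rw [map_mul, aeval_X]
      rw [h] at hw
      obtain ⟨z, hz, rfl⟩ := exists_of_mem_spectrum_complexify_aeval hw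
      have hz0 := aeval_eq_zero_of_mem_spectrum_complexify hA hz
      rw [map_mul, aeval_X, hpz z hz0]
      exact signStem_zero_mul_mem_slitPlane (hfz z hz0)
    · obtain ⟨z, hz, rfl⟩ := exists_of_mem_spectrum_complexify_aeval hw
      exact hqz z (aeval_eq_zero_of_mem_spectrum_complexify hA hz)
    · obtain ⟨k, hk⟩ := hq
      have := congrArg (aeval A) hk
      rw [map_mul, hA, zero_mul, map_sub, sub_eq_zero, map_pow, map_mul, aeval_X, pow_two] at this
      exact this

/-- The minimal polynomial of a nonsingular matrix over the reals does not vanish at zero. -/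
theorem exists_annihilating_polynomial {A : Matrix n n K} (hA : IsUnit A) :
    ∃ f : ℝ[X], f ≠ 0 ∧ aeval (0 : ℂ) f ≠ 0 ∧ aeval A f = 0 := by
  have hint : IsIntegral ℝ A := Algebra.IsIntegral.isIntegral A
  refine ⟨minpoly ℝ A, minpoly.ne_zero hint, fun h => ?_, minpoly.aeval ℝ A⟩
  have h0 : (minpoly ℝ A).coeff 0 = 0 := by
    rw [aeval_def, eval₂_at_zero] at h
    simpa using h
  obtain ⟨g, hg⟩ := X_dvd_iff.2 h0
  have hg0 : g ≠ 0 := by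
    rintro rfl
    exact minpoly.ne_zero hint (by rw [hg, mul_zero])
  have h1 : aeval A g = 0 := by
    have := minpoly.aeval ℝ A
    rw [hg, map_mul, aeval_X] at this
    exact hA.mul_right_eq_zero.1 this
  have h2 := natDegree_le_of_dvd (minpoly.dvd ℝ A h1) hg0
  rw [hg, natDegree_X_mul hg0] at h2
  omega

theorem mul_aeval_eq_of_mul_eq {A B F : Matrix n n K} (h : F * A = B * F) (p : ℝ[X]) :
    F * aeval A p = aeval B p * F := by
  induction p using Polynomial.induction_on' with
  | add p q hp hq => rw [map_add, map_add, mul_add, add_mul, hp, hq]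
  | monomial k a =>
    have hk : F * A ^ k = B ^ k * F := (SemiconjBy.pow_right (show SemiconjBy F A B from h) k).eq
    rw [aeval_monomial, aeval_monomial, mul_assoc, ← hk, ← mul_assoc, ← Algebra.commutes a F,
      mul_assoc]

end MatrixFunctions

/-! ### The adjoint, neutrality, and inertia -/

section IndefiniteAlgebra

variable {K : Type*} [RCLike K] {n : Type*} [Fintype n] [DecidableEq n]

open Matrix Polynomial

theorem hAdjoint_eq_iff {H : Matrix n n K} (hd : IsUnit H.det) {A B : Matrix n n K} :
    hAdjoint H A = B ↔ Aᴴ * H = H * B := by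
  unfold hAdjoint
  constructor
  · rintro rfl
    rw [mul_assoc, mul_nonsing_inv_cancel_left _ _ hd]
  · intro h
    rw [mul_assoc, h, nonsing_inv_mul_cancel_left _ _ hd]

theorem hAdjoint_mul {H : Matrix n n K} (hd : IsUnit H.det) (A B : Matrix n n K) :
    hAdjoint H (A * B) = hAdjoint H B * hAdjoint H A := by
  unfold hAdjoint
  simp only [conjTranspose_mul, mul_assoc, mul_nonsing_inv_cancel_left _ _ hd]

theorem hAdjoint_one {H : Matrix n n K} (hd : IsUnit H.det) : hAdjoint H (1 : Matrix n n K) = 1 := by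
  rw [hAdjoint_eq_iff hd, conjTranspose_one, one_mul, mul_one]

theorem hAdjoint_sub (H A B : Matrix n n K) :
    hAdjoint H (A - B) = hAdjoint H A - hAdjoint H B := by
  unfold hAdjoint
  rw [conjTranspose_sub, mul_sub, sub_mul]

theorem hAdjoint_hAdjoint {H : Matrix n n K} (hH : H.IsHermitian) (hd : IsUnit H.det)
    (A : Matrix n n K) : hAdjoint H (hAdjoint H A) = A := by
  rw [hAdjoint_eq_iff hd]
  have h : Aᴴ * H = H * hAdjoint H A := (hAdjoint_eq_iff hd).1 rfl
  have := congrArg conjTranspose h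
  rw [conjTranspose_mul, conjTranspose_mul, conjTranspose_conjTranspose, hH.eq] at this
  exact this.symm

theorem hAdjoint_aeval {H : Matrix n n K} (hd : IsUnit H.det) (A : Matrix n n K) (p : ℝ[X]) :
    hAdjoint H (aeval A p) = aeval (hAdjoint H A) p := by
  rw [hAdjoint_eq_iff hd]
  have h : Aᴴ * H = H * hAdjoint H A := (hAdjoint_eq_iff hd).1 rfl
  rw [mul_aeval_eq_of_mul_eq h.symm p]
  congr 1
  induction p using Polynomial.induction_on' with
  | add p q hp hq => rw [map_add, map_add, conjTranspose_add, hp, hq]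
  | monomial k a =>
    simp only [aeval_monomial, ← Algebra.smul_def, conjTranspose_smul, conjTranspose_pow, star_trivial]

/-- Neutrality of the negative eigenspace of an involution `X`, which is the range of `1 - X`, as a
matrix identity. -/
theorem isHNeutralInvolutory_iff {H : Matrix n n K} (hd : IsUnit H.det) {X : Matrix n n K} :
    IsHNeutralInvolutory H X ↔ X * X = 1 ∧ (1 - hAdjoint H X) * (1 - X) = 0 := by
  unfold IsHNeutralInvolutory
  refine and_congr_right fun hX => ?_
  have hform : ∀ u v, hInner H ((1 - X) *ᵥ u) ((1 - X) *ᵥ v) =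
      star u ⬝ᵥ ((H * ((1 - hAdjoint H X) * (1 - X))) *ᵥ v) := by
    intro u v
    have h : (1 - X)ᴴ * H = H * (1 - hAdjoint H X) := by
      rw [← hAdjoint_eq_iff hd, hAdjoint_sub, hAdjoint_one hd]
    unfold hInner
    rw [← mul_assoc, ← h, star_mulVec, ← dotProduct_mulVec, mulVec_mulVec, mulVec_mulVec]
  constructor
  · intro h
    have hneg : ∀ u, X *ᵥ ((1 - X) *ᵥ u) = -((1 - X) *ᵥ u) := by
      intro u
      rw [mulVec_mulVec, mul_sub, hX, ← neg_mulVec, mul_one, neg_sub]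
    have h0 : H * ((1 - hAdjoint H X) * (1 - X)) = 0 := by
      ext i j
      have := hform (Pi.single i 1) (Pi.single j 1)
      rw [h _ _ (hneg _) (hneg _)] at this
      simpa using this.symm
    have := congrArg (H⁻¹ * ·) h0
    simpa [nonsing_inv_mul_cancel_left _ _ hd] using this
  · intro h u v hu hv
    have half : ∀ w, X *ᵥ w = -w → (1 - X) *ᵥ ((2⁻¹ : K) • w) = w := by
      intro w hw
      rw [sub_mulVec, one_mulVec, mulVec_smul, hw, smul_neg, sub_neg_eq_add, ← add_smul]
      norm_num
    rw [← half u hu, ← half v hv, hform, h, mul_zero, zero_mulVec, dotProduct_zero]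

/-- One half of the law of inertia for real diagonal forms: a congruence does not increase the
number of positive entries. Otherwise some nonzero vector in the coordinate space of the positive
`ε'` would be mapped to one on which the form of `ε` is not positive. -/
theorem card_pos_le_of_congruent {T : Matrix n n K} {ε ε' : n → ℝ}
    (h : Tᴴ * diagonal (fun i => (ε i : K)) * T = diagonal (fun i => (ε' i : K))) :
    Fintype.card {i // 0 < ε' i} ≤ Fintype.card {i // 0 < ε i} := by
  by_contra! hlt
  -- `E` extends a vector by zero, and `f` is the compression of `T` to the positive coordinates.
  let E : ({i // 0 < ε' i} → K) →ₗ[K] (n → K) := Function.ExtendByZero.linearMap K Subtype.val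
  let f : ({i // 0 < ε' i} → K) →ₗ[K] ({i // 0 < ε i} → K) :=
    LinearMap.funLeft K K Subtype.val ∘ₗ T.mulVecLin ∘ₗ E
  have hker : LinearMap.ker f ≠ ⊥ := LinearMap.ker_ne_bot_of_finrank_lt (by simpa using hlt)
  obtain ⟨y, hy, hy0⟩ := (Submodule.ne_bot_iff _).1 hker
  have hquad : ∀ (d : n → ℝ) (x : n → K),
      star x ⬝ᵥ (diagonal (fun i => (d i : K)) *ᵥ x) = ((∑ i, d i * ‖x i‖ ^ 2 : ℝ) : K) := by
    intro d x
    simp only [dotProduct, mulVec_diagonal, Pi.star_apply]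
    push_cast
    refine Finset.sum_congr rfl fun i _ => ?_
    rw [mul_left_comm, RCLike.star_def, RCLike.conj_mul]
  have hEy : ∀ i, E y i = if hi : 0 < ε' i then y ⟨i, hi⟩ else 0 := by
    intro i
    show Function.extend Subtype.val y 0 i = _
    split_ifs with hi
    · exact Subtype.val_injective.extend_apply y 0 ⟨i, hi⟩
    · rw [Function.extend_apply' _ _ _ (by rintro ⟨a, rfl⟩; exact hi a.2)]
      rfl
  have hpos : 0 < ∑ i, ε' i * ‖E y i‖ ^ 2 := by
    obtain ⟨a, ha⟩ := Function.ne_iff.1 hy0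
    refine Finset.sum_pos' (fun i _ => ?_) ⟨a.1, Finset.mem_univ _, ?_⟩
    · rw [hEy]
      split_ifs with hi
      · positivity
      · simp
    · rw [hEy, dif_pos a.2]
      exact mul_pos a.2 (pow_pos (norm_pos_iff.2 ha) 2)
  have hnonpos : ∑ i, ε i * ‖(T *ᵥ E y) i‖ ^ 2 ≤ 0 := by
    refine Finset.sum_nonpos fun i _ => ?_
    by_cases hi : 0 < ε i
    · have h0 : (T *ᵥ E y) i = 0 := congrFun hy ⟨i, hi⟩
      rw [h0]
      simp
    · exact mul_nonpos_of_nonpos_of_nonneg (not_lt.1 hi) (by positivity)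
  have heq : (∑ i, ε i * ‖(T *ᵥ E y) i‖ ^ 2 : ℝ) = ∑ i, ε' i * ‖E y i‖ ^ 2 := by
    have : ((∑ i, ε i * ‖(T *ᵥ E y) i‖ ^ 2 : ℝ) : K) = ((∑ i, ε' i * ‖E y i‖ ^ 2 : ℝ) : K) := by
      rw [← hquad, ← hquad, ← h, star_mulVec, ← dotProduct_mulVec, mulVec_mulVec, mulVec_mulVec,
        mul_assoc]
    exact RCLike.ofReal_injective this
  linarith

theorem exists_unitary_diagonal {M : Matrix n n K} (hM : M.IsHermitian) :
    ∃ (V : Matrix n n K) (d : n → ℝ), Vᴴ * V = 1 ∧ V * Vᴴ = 1 ∧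
      M * V = V * diagonal (fun i => (d i : K)) := by
  refine ⟨hM.eigenvectorUnitary, hM.eigenvalues, Unitary.coe_star_mul_self _,
    Unitary.coe_mul_star_self _, ?_⟩
  have h := hM.spectral_theorem
  rw [Unitary.conjStarAlgAut_apply] at h
  refine (congrArg (· * (hM.eigenvectorUnitary : Matrix n n K)) h).trans ?_
  rw [mul_assoc, Unitary.coe_star_mul_self, mul_one]
  rfl

open scoped ComplexOrder MatrixOrder Matrix.Norms.L2Operator in
/-- An involution is selfadjoint for the positive definite form of `1 + Pᴴ P`, hence similar to a
Hermitian one. -/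
theorem exists_isHermitian_conj_of_involution {P : Matrix n n K} (hP : P * P = 1) :
    ∃ R R' Q : Matrix n n K, R * R' = 1 ∧ R' * R = 1 ∧ R * P = Q * R ∧ Q.IsHermitian := by
  have hG : (1 + Pᴴ * P).PosDef :=
    PosDef.one.add_posSemidef (posSemidef_conjTranspose_mul_self P)
  obtain ⟨R, hR, hRG⟩ : ∃ R : Matrix n n K, IsUnit R ∧ 1 + Pᴴ * P = Rᴴ * R := by
    exact CStarAlgebra.isStrictlyPositive_iff_eq_star_mul_self.mp hG.isStrictlyPositive
  obtain ⟨R', h1, h2⟩ := isUnit_iff_exists.1 hR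
  have h2c : ∀ B, R' * (R * B) = B := fun B => by rw [← mul_assoc, h2, one_mul]
  have h3c : ∀ B, R'ᴴ * (Rᴴ * B) = B := fun B => by
    rw [← mul_assoc, ← conjTranspose_mul, h1, conjTranspose_one, one_mul]
  have hPG : Rᴴ * R * P = Pᴴ * (Rᴴ * R) := by
    have hP' : Pᴴ * Pᴴ = 1 := by rw [← conjTranspose_mul, hP, conjTranspose_one]
    rw [← hRG, add_mul, mul_add, mul_assoc, hP, ← mul_assoc, hP']
    simp only [one_mul, mul_one]
    rw [add_comm]
  refine ⟨R, R', R * P * R', h1, h2, by rw [mul_assoc, mul_assoc, h2, mul_one], ?_⟩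
  unfold Matrix.IsHermitian
  rw [conjTranspose_mul, conjTranspose_mul]
  have := congrArg (fun B => R'ᴴ * B * R') hPG
  simp only [mul_assoc, h3c, h1, mul_one] at this
  rw [mul_assoc, ← this]

end IndefiniteAlgebra

/-! ### Diagonalization and existence of neutral involutions -/

section NeutralInvolutions

variable {K : Type*} [RCLike K] {n : Type*} [Fintype n] [DecidableEq n]

open Matrix

omit [DecidableEq n] in
/-- An involution of the index set which fixes the places with `σ = 1` and exchanges the places
with `ε = 1`, `σ = -1` and those with `ε = -1`, `σ = -1`. -/
theorem exists_involutive_swapping_signs {ε σ : n → ℝ} (hε : ∀ i, ε i = 1 ∨ ε i = -1)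
    (hσ : ∀ i, σ i = 1 ∨ σ i = -1)
    (hcard : Fintype.card {i // ε i = 1 ∧ σ i = -1} = Fintype.card {i // ε i = -1 ∧ σ i = -1}) :
    ∃ π : n → n, (∀ i, π (π i) = i) ∧ (∀ i, σ (π i) = σ i) ∧ (∀ i, ε (π i) = ε i * σ i) ∧
      ∀ i, σ i = 1 → π i = i := by
  classical
  let e := Fintype.equivOfCardEq hcard
  let π : n → n := fun i => if h : ε i = 1 ∧ σ i = -1 then (e ⟨i, h⟩).1 else
    if h : ε i = -1 ∧ σ i = -1 then (e.symm ⟨i, h⟩).1 else i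
  have hne : (-1 : ℝ) ≠ 1 := by norm_num
  have h1 : ∀ i (h : ε i = 1 ∧ σ i = -1), π i = (e ⟨i, h⟩).1 := fun i h => dif_pos h
  have h2 : ∀ i (h : ε i = -1 ∧ σ i = -1), π i = (e.symm ⟨i, h⟩).1 := fun i h => by
    have h' : ¬(ε i = 1 ∧ σ i = -1) := fun hc => hne (h.1 ▸ hc.1)
    simp only [π, dif_neg h', dif_pos h]
  have h3 : ∀ i, σ i = 1 → π i = i := fun i h => by
    have h' : ∀ c, ¬(ε i = c ∧ σ i = -1) := fun c hc => hne (by rw [← hc.2, h])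
    simp only [π, dif_neg (h' _)]
  have hcases : ∀ i, σ i = 1 ∨ (ε i = 1 ∧ σ i = -1) ∨ (ε i = -1 ∧ σ i = -1) := fun i => by
    rcases hσ i with h | h
    · exact Or.inl h
    · rcases hε i with h' | h'
      · exact Or.inr (Or.inl ⟨h', h⟩)
      · exact Or.inr (Or.inr ⟨h', h⟩)
  refine ⟨π, fun i => ?_, fun i => ?_, fun i => ?_, h3⟩
  · rcases hcases i with h | h | h
    · rw [h3 i h, h3 i h]
    · rw [h1 i h, h2 _ (e ⟨i, h⟩).2]
      simp
    · rw [h2 i h, h1 _ (e.symm ⟨i, h⟩).2]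
      simp
  · rcases hcases i with h | h | h
    · rw [h3 i h]
    · rw [h1 i h, h.2, (e ⟨i, h⟩).2.2]
    · rw [h2 i h, h.2, (e.symm ⟨i, h⟩).2.2]
  · rcases hcases i with h | h | h
    · rw [h3 i h, h, mul_one]
    · rw [h1 i h, h.1, h.2, (e ⟨i, h⟩).2.1, one_mul]
    · rw [h2 i h, h.1, h.2, (e.symm ⟨i, h⟩).2.1]
      norm_num

theorem eq_one_or_eq_neg_one_of_diagonal_mul_self {d : n → ℝ}
    (h : diagonal (fun i => (d i : K)) * diagonal (fun i => (d i : K)) = 1) (i : n) :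
    d i = 1 ∨ d i = -1 := by
  rw [diagonal_mul_diagonal, ← diagonal_one] at h
  have h1 : ((d i * d i : ℝ) : K) = ((1 : ℝ) : K) := by
    have := congrFun (diagonal_injective h) i
    push_cast
    exact this
  exact mul_self_eq_one_iff.1 (RCLike.ofReal_injective h1)

/-- Commuting Hermitian involutions `J`, `Q` are simultaneously diagonalized by any unitary matrix
which diagonalizes `J + 2 Q`: the values `±1 ± 2` are distinct, so that `J` is a polynomial in this
matrix. -/
theorem exists_unitary_diagonal_of_commuting_involutions {J Q : Matrix n n K}
    (hJ : J.IsHermitian) (hQ : Q.IsHermitian) (hJJ : J * J = 1) (hQQ : Q * Q = 1)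
    (hJQ : J * Q = Q * J) :
    ∃ (V : Matrix n n K) (ε σ : n → ℝ), Vᴴ * V = 1 ∧ V * Vᴴ = 1 ∧
      J * V = V * diagonal (fun i => (ε i : K)) ∧ Q * V = V * diagonal (fun i => (σ i : K)) := by
  have hM : (J + Q + Q).IsHermitian := (hJ.add hQ).add hQ
  obtain ⟨V, d, h1, h2, h3⟩ := exists_unitary_diagonal hM
  set D : Matrix n n K := diagonal (fun i => (d i : K)) with hD
  -- `(J + 2 Q) ^ 3 = 13 J + 14 Q`, hence `6 J = (J + 2 Q) ^ 3 - 7 (J + 2 Q)`.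
  have hMM : (J + Q + Q) * (J + Q + Q) = (5 : K) • (1 : Matrix n n K) + (4 : K) • (J * Q) := by
    simp only [add_mul, mul_add, hJJ, hQQ, ← hJQ]
    module
  have hM3 : (J + Q + Q) * ((J + Q + Q) * (J + Q + Q)) =
      (13 : K) • J + (14 : K) • Q := by
    have hQJQ : Q * (J * Q) = J := by rw [hJQ, ← mul_assoc, hQQ, one_mul]
    have hJJQ : J * (J * Q) = Q := by rw [← mul_assoc, hJJ, one_mul]
    rw [hMM]
    simp only [add_mul, mul_add, mul_smul_comm, mul_one, hQJQ, hJJQ]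
    module
  have hM3V : (J + Q + Q) * ((J + Q + Q) * (J + Q + Q)) * V = V * (D * D * D) := by
    rw [mul_assoc, mul_assoc, h3, ← mul_assoc (J + Q + Q) V, h3, ← mul_assoc, ← mul_assoc, h3,
      mul_assoc, mul_assoc, mul_assoc]
  have hJe : (6 : K) • J = (J + Q + Q) * ((J + Q + Q) * (J + Q + Q)) - (7 : K) • (J + Q + Q) := by
    rw [hM3]
    module
  have hJV : J * V = V * diagonal (fun i => (((d i * d i * d i - 7 * d i) / 6 : ℝ) : K)) := by
    have h6 : diagonal (fun i => (((d i * d i * d i - 7 * d i) / 6 : ℝ) : K)) =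
        (6 : K)⁻¹ • (D * D * D - (7 : K) • D) := by
      rw [hD, diagonal_mul_diagonal, diagonal_mul_diagonal, ← diagonal_smul, diagonal_sub,
        ← diagonal_smul]
      congr 1
      funext i
      simp only [Pi.smul_apply, smul_eq_mul]
      push_cast
      ring
    have h7 : J = (6 : K)⁻¹ • ((6 : K) • J) := by
      rw [smul_smul, inv_mul_cancel₀ (by norm_num), one_smul]
    rw [h6, h7, hJe, smul_mul_assoc, sub_mul, hM3V, smul_mul_assoc, h3, mul_smul_comm, mul_sub,
      mul_smul_comm]
  refine ⟨V, _, fun i => (d i - (d i * d i * d i - 7 * d i) / 6) / 2, h1, h2, hJV, ?_⟩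
  have h8 : diagonal (fun i => (((d i - (d i * d i * d i - 7 * d i) / 6) / 2 : ℝ) : K)) =
      (2 : K)⁻¹ • (D - diagonal (fun i => (((d i * d i * d i - 7 * d i) / 6 : ℝ) : K))) := by
    rw [hD, diagonal_sub, ← diagonal_smul]
    congr 1
    funext i
    simp only [Pi.smul_apply, smul_eq_mul]
    push_cast
    ring
  have h9 : Q = (2 : K)⁻¹ • ((J + Q + Q) - J) := by
    have : J + Q + Q - J = (2 : K) • Q := by module
    rw [this, smul_smul, inv_mul_cancel₀ (by norm_num), one_smul]
  rw [h8, mul_smul_comm, mul_sub, ← h3, ← hJV, ← sub_mul, ← smul_mul_assoc, ← h9]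

/-- A nonsingular Hermitian form `H` which commutes with a Hermitian involution `Q` is congruent to a
Hermitian involution `J`, by a change of basis which takes `Q` to a Hermitian involution `Q'`
commuting with `J`: diagonalize `H` and rescale. The scaling matrix is a function of the
diagonalized `H` and therefore commutes with `Q'`. -/
theorem exists_congruence_isHermitian_involution {H Q : Matrix n n K} (hH : H.IsHermitian)
    (hd : IsUnit H.det) (hQ : Q.IsHermitian) (hQQ : Q * Q = 1) (hHQ : H * Q = Q * H) :
    ∃ T T' J Q' : Matrix n n K, T * T' = 1 ∧ T' * T = 1 ∧ Tᴴ * H * T = J ∧ Q * T = T * Q' ∧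
      J.IsHermitian ∧ Q'.IsHermitian ∧ J * J = 1 ∧ Q' * Q' = 1 ∧ J * Q' = Q' * J := by
  obtain ⟨U, d, h1, h2, h3⟩ := exists_unitary_diagonal hH
  set D : Matrix n n K := diagonal (fun i => (d i : K)) with hD
  have hUHU : Uᴴ * H * U = D := by rw [mul_assoc, h3, ← mul_assoc, h1, one_mul]
  have hUc : ∀ B, U * (Uᴴ * B) = B := fun B => by rw [← mul_assoc, h2, one_mul]
  have hUc' : ∀ B, Uᴴ * (U * B) = B := fun B => by rw [← mul_assoc, h1, one_mul]
  have hd0 : ∀ i, d i ≠ 0 := by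
    have hU : IsUnit D := by
      have hH' : IsUnit H := (isUnit_iff_isUnit_det H).2 hd
      rw [← hUHU]
      exact ((IsUnit.of_mul_eq_one _ h1).mul hH').mul (IsUnit.of_mul_eq_one _ h2)
    intro i hi
    rw [isUnit_iff_isUnit_det, hD, det_diagonal, isUnit_iff_ne_zero, Finset.prod_ne_zero_iff] at hU
    exact hU i (Finset.mem_univ i) (by rw [hi, RCLike.ofReal_zero])
  set P := Uᴴ * Q * U with hP
  have hPP : P * P = 1 := by
    rw [hP]
    simp only [mul_assoc, hUc]
    rw [← mul_assoc Q, hQQ, one_mul, h1]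
  have hPH : P.IsHermitian := isHermitian_conjTranspose_mul_mul U hQ
  have hDP : D * P = P * D := by
    rw [← hUHU, hP]
    simp only [mul_assoc, hUc]
    rw [← mul_assoc H, hHQ, mul_assoc]
  have hcomm : ∀ f : ℝ → ℝ, diagonal (fun i => (f (d i) : K)) * P =
      P * diagonal (fun i => (f (d i) : K)) := by
    intro f
    ext i j
    have := congrFun (congrFun hDP i) j
    rw [hD, diagonal_mul, mul_diagonal, mul_comm, mul_eq_mul_left_iff] at this
    rw [diagonal_mul, mul_diagonal, mul_comm, mul_eq_mul_left_iff]
    rcases this with h | h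
    · exact Or.inl (by rw [RCLike.ofReal_injective h])
    · exact Or.inr h
  set E : Matrix n n K := diagonal (fun i => (((√|d i|)⁻¹ : ℝ) : K)) with hE
  set E' : Matrix n n K := diagonal (fun i => ((√|d i| : ℝ) : K)) with hE'
  have hs : ∀ i, √|d i| ≠ 0 := fun i => (Real.sqrt_pos.2 (abs_pos.2 (hd0 i))).ne'
  have hEE' : E * E' = 1 := by
    rw [hE, hE', diagonal_mul_diagonal, ← diagonal_one]
    congr 1
    funext i
    rw [← RCLike.ofReal_mul, inv_mul_cancel₀ (hs i), RCLike.ofReal_one]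
  have hE'E : E' * E = 1 := mul_eq_one_comm.1 hEE'
  have hEH : Eᴴ = E := by
    rw [hE, diagonal_conjTranspose]
    congr 1
    funext i
    simp
  have hEP : E * P = P * E := hcomm fun t => (√|t|)⁻¹
  have hDH : D.IsHermitian := hUHU ▸ isHermitian_conjTranspose_mul_mul U hH
  refine ⟨U * E, E' * Uᴴ, E * D * E, P, ?_, ?_, ?_, ?_, ?_, hPH, ?_, hPP, ?_⟩
  · rw [mul_assoc, ← mul_assoc E, hEE', one_mul, h2]
  · rw [mul_assoc, hUc', hE'E]
  · rw [conjTranspose_mul, hEH, ← hUHU]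
    simp only [mul_assoc]
  · rw [mul_assoc, hEP, hP]
    simp only [mul_assoc, hUc]
  · have := isHermitian_conjTranspose_mul_mul E hDH
    rwa [hEH] at this
  · rw [hE, hD, diagonal_mul_diagonal, diagonal_mul_diagonal, diagonal_mul_diagonal, ← diagonal_one]
    congr 1
    funext i
    rw [← RCLike.ofReal_mul, ← RCLike.ofReal_mul, ← RCLike.ofReal_mul, ← RCLike.ofReal_one]
    congr 1
    have h4 : √|d i| * √|d i| = |d i| := Real.mul_self_sqrt (abs_nonneg _)
    have h5 : d i * d i = |d i| * |d i| := (abs_mul_abs_self _).symm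
    field_simp [hs i]
    nlinarith
  · rw [mul_assoc, hEP, mul_assoc, ← mul_assoc D, hDP, ← mul_assoc, ← mul_assoc, hEP]
    simp only [mul_assoc]

/-- Simultaneous reduction of a Hermitian form `H` and an `H`-selfadjoint involution `P` to diagonal
matrices with entries `±1`. -/
theorem exists_simultaneous_diagonal {H P : Matrix n n K} (hH : H.IsHermitian)
    (hd : IsUnit H.det) (hPP : P * P = 1) (hP : IsHSelfadjoint H P) :
    ∃ (T T' : Matrix n n K) (ε σ : n → ℝ), T * T' = 1 ∧ T' * T = 1 ∧
      (∀ i, ε i = 1 ∨ ε i = -1) ∧ (∀ i, σ i = 1 ∨ σ i = -1) ∧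
      Tᴴ * H * T = diagonal (fun i => (ε i : K)) ∧ P * T = T * diagonal (fun i => (σ i : K)) := by
  obtain ⟨R, R', Q, h1, h2, hRP, hQ⟩ := exists_isHermitian_conj_of_involution hPP
  have hPH : Pᴴ * H = H * P := (hAdjoint_eq_iff hd).1 hP
  have hPR : P * R' = R' * Q := by
    calc P * R' = R' * (R * P) * R' := by rw [← mul_assoc R', h2, one_mul]
      _ = R' * Q := by rw [hRP, mul_assoc, mul_assoc Q, h1, mul_one]
  have hQQ : Q * Q = 1 := by
    calc Q * Q = Q * (Q * R) * R' := by rw [mul_assoc, mul_assoc Q R, h1, mul_one]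
      _ = R * (P * P) * R' := by rw [← hRP, ← mul_assoc, ← hRP, mul_assoc R]
      _ = 1 := by rw [hPP, mul_one, h1]
  have hR : IsUnit R' := isUnit_iff_exists.2 ⟨R, h2, h1⟩
  have hd1 : IsUnit (R'ᴴ * H * R').det := by
    rw [← isUnit_iff_isUnit_det] at hd ⊢
    exact (hR.star.mul hd).mul hR
  have hcomm : R'ᴴ * H * R' * Q = Q * (R'ᴴ * H * R') := by
    have h3 : R'ᴴ * Pᴴ = Q * R'ᴴ := by
      rw [← conjTranspose_mul, hPR, conjTranspose_mul, hQ.eq]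
    rw [mul_assoc, ← hPR, mul_assoc, ← mul_assoc H, ← hPH, ← mul_assoc, ← mul_assoc, h3]
    simp only [mul_assoc]
  obtain ⟨T, T', J, Q', h4, h5, hJ, hQT, hJh, hQh, hJJ, hQQ', hJQ⟩ :=
    exists_congruence_isHermitian_involution (isHermitian_conjTranspose_mul_mul R' hH) hd1 hQ hQQ
      hcomm
  obtain ⟨V, ε, σ, h6, h7, hJV, hQV⟩ :=
    exists_unitary_diagonal_of_commuting_involutions hJh hQh hJJ hQQ' hJQ
  have key : ∀ (A : Matrix n n K) (c : n → ℝ), A * V = V * diagonal (fun i => (c i : K)) →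
      A * A = 1 → ∀ i, c i = 1 ∨ c i = -1 := by
    intro A c hA hAA
    refine eq_one_or_eq_neg_one_of_diagonal_mul_self (K := K) ?_
    calc diagonal (fun i => (c i : K)) * diagonal (fun i => (c i : K))
        = Vᴴ * (V * diagonal (fun i => (c i : K))) * diagonal (fun i => (c i : K)) := by
          rw [← mul_assoc Vᴴ, h6, one_mul]
      _ = Vᴴ * (A * A) * V := by
          rw [← hA, mul_assoc, mul_assoc, ← hA, mul_assoc Vᴴ, mul_assoc A]
      _ = 1 := by rw [hAA, mul_one, h6]
  refine ⟨R' * T * V, Vᴴ * T' * R, ε, σ, ?_, ?_, key _ _ hJV hJJ, key _ _ hQV hQQ', ?_, ?_⟩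
  · calc R' * T * V * (Vᴴ * T' * R) = R' * (T * (V * Vᴴ) * T') * R := by simp only [mul_assoc]
      _ = 1 := by rw [h7, mul_one, h4, mul_one, h2]
  · calc Vᴴ * T' * R * (R' * T * V) = Vᴴ * (T' * (R * R') * T) * V := by simp only [mul_assoc]
      _ = 1 := by rw [h1, mul_one, h5, mul_one, h6]
  · calc (R' * T * V)ᴴ * H * (R' * T * V) = Vᴴ * (Tᴴ * (R'ᴴ * H * R') * T) * V := by
          simp only [conjTranspose_mul, mul_assoc]
      _ = _ := by rw [hJ, mul_assoc, hJV, ← mul_assoc, h6, one_mul]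
  · rw [← mul_assoc, ← mul_assoc, hPR, mul_assoc R', hQT, mul_assoc, mul_assoc, hQV]
    simp only [mul_assoc]

/-- If `P = W^[H] W` is an involution, then `H` and `H P` are congruent, so that `H` has as many
positive as negative squares on the negative eigenspace of `P`. Exchanging them in pairs gives an
`H`-normal `H`-neutral involution `X` with `X^[H] X = P`. -/
theorem exists_neutral_involution_of_hAdjoint_mul_self {H P W : Matrix n n K} (hH : H.IsHermitian)
    (hd : IsUnit H.det) (hPP : P * P = 1) (hW : hAdjoint H W * W = P) :
    ∃ X, IsHNormalNeutralInvolutory H X ∧ hAdjoint H X * X = P := by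
  have hP : IsHSelfadjoint H P := by
    rw [IsHSelfadjoint, ← hW, hAdjoint_mul hd, hAdjoint_hAdjoint hH hd]
  obtain ⟨T, T', ε, σ, h1, h2, hε, hσ, hT, hPT⟩ := exists_simultaneous_diagonal hH hd hPP hP
  have hcong : (T' * W * T)ᴴ * diagonal (fun i => (ε i : K)) * (T' * W * T) =
      diagonal (fun i => ((ε i * σ i : ℝ) : K)) := by
    have hWH : Wᴴ * H * W = H * P := by
      rw [(hAdjoint_eq_iff hd).1 rfl, mul_assoc, hW]
    have h3 : T'ᴴ * Tᴴ = 1 := by rw [← conjTranspose_mul, h1, conjTranspose_one]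
    calc (T' * W * T)ᴴ * diagonal (fun i => (ε i : K)) * (T' * W * T)
        = Tᴴ * Wᴴ * (T'ᴴ * Tᴴ) * H * (T * T') * W * T := by
          rw [← hT]
          simp only [conjTranspose_mul, mul_assoc]
      _ = Tᴴ * (Wᴴ * H * W) * T := by
          rw [h1, h3]
          simp only [mul_assoc, mul_one]
      _ = Tᴴ * H * (P * T) := by
          rw [hWH]
          simp only [mul_assoc]
      _ = _ := by
          rw [hPT, ← mul_assoc, hT, diagonal_mul_diagonal]
          congr 1
          funext i
          push_cast
          rfl
  -- Both halves of the law of inertia, for `ε` and `ε σ`, and for their negatives.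
  have hcard : Fintype.card {i // ε i = 1 ∧ σ i = -1} =
      Fintype.card {i // ε i = -1 ∧ σ i = -1} := by
    have hpos := card_pos_le_of_congruent hcong
    have hneg := card_pos_le_of_congruent (K := K) (T := T' * W * T) (ε := fun i => -ε i)
      (ε' := fun i => -(ε i * σ i)) (by
        have := congrArg Neg.neg hcong
        rw [← neg_mul, ← mul_neg, diagonal_neg, diagonal_neg] at this
        simpa using! this)
    have hsplit : ∀ (a b c d : n → Prop) [DecidablePred a] [DecidablePred b] [DecidablePred c]
        [DecidablePred d],
        (∀ i, (if a i then 1 else 0) + (if b i then 1 else 0) =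
          (if c i then 1 else 0) + (if d i then 1 else 0)) →
        Fintype.card {i // a i} + Fintype.card {i // b i} =
          Fintype.card {i // c i} + Fintype.card {i // d i} := by
      intro a b c d _ _ _ _ h
      simp only [Fintype.card_subtype, Finset.card_filter]
      rw [← Finset.sum_add_distrib, ← Finset.sum_add_distrib]
      exact Finset.sum_congr rfl fun i _ => h i
    have e1 := hsplit (fun i => 0 < ε i) (fun i => ε i = -1 ∧ σ i = -1)
      (fun i => 0 < ε i * σ i) (fun i => ε i = 1 ∧ σ i = -1) (fun i => by
        rcases hε i with h | h <;> rcases hσ i with h' | h' <;> simp only [h, h'] <;> norm_num)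
    have e2 := hsplit (fun i => 0 < -ε i) (fun i => ε i = 1 ∧ σ i = -1)
      (fun i => 0 < -(ε i * σ i)) (fun i => ε i = -1 ∧ σ i = -1) (fun i => by
        rcases hε i with h | h <;> rcases hσ i with h' | h' <;> simp only [h, h'] <;> norm_num)
    omega
  obtain ⟨π, hππ, hσπ, hεπ, hfix⟩ := exists_involutive_swapping_signs hε hσ hcard
  -- `N` is the matrix of `X` in the new basis, and `Dσ * N` that of `X^[H]`.
  let N : Matrix n n K := of fun i j => if π i = j then 1 else 0
  have hswap : ∀ i j, π i = j ↔ π j = i := fun i j =>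
    ⟨fun h => by rw [← h, hππ], fun h => by rw [← h, hππ]⟩
  set Dε : Matrix n n K := diagonal (fun i => (ε i : K)) with hDε
  set Dσ : Matrix n n K := diagonal (fun i => (σ i : K)) with hDσ
  have hNN : N * N = 1 := by
    ext i j
    rw [mul_apply, Finset.sum_eq_single (π i) (fun k _ hk => by simp [N, hk.symm]) (by simp)]
    simp [N, hππ, one_apply]
  have hNH : Nᴴ = N := by
    ext i j
    simp only [N, conjTranspose_apply, of_apply, hswap j i]
    split_ifs <;> simp
  have hσN : Dσ * N = N * Dσ := by
    ext i j
    rw [hDσ, diagonal_mul, mul_diagonal]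
    by_cases h : π i = j
    · rw [← h, hσπ, mul_comm]
    · simp [N, h]
  have hεN : Dε * (Dσ * N) = N * Dε := by
    ext i j
    rw [hDε, hDσ, diagonal_mul, diagonal_mul, mul_diagonal]
    by_cases h : π i = j
    · rw [← h, hεπ]
      push_cast
      ring
    · simp [N, h]
  have hfixN : (1 - Dσ * N) * (1 - N) = 0 := by
    have h4 : (1 - Dσ * N) * (1 - N) = (1 + Dσ) * (1 - N) := by
      have h5 : Dσ * N * N = Dσ := by rw [mul_assoc, hNN, mul_one]
      simp only [sub_mul, mul_sub, add_mul, one_mul, mul_one, h5]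
      abel
    rw [h4]
    have h5 : (1 + Dσ) = diagonal (fun i => 1 + (σ i : K)) := by
      rw [hDσ, ← diagonal_one, diagonal_add]
    ext i j
    rw [h5, diagonal_mul]
    rcases hσ i with h | h
    · simp [N, hfix i h, one_apply]
    · simp [h]
  have hT'T : ∀ B, T' * (T * B) = B := fun B => by rw [← mul_assoc, h2, one_mul]
  have hadj : hAdjoint H (T * N * T') = T * (Dσ * N) * T' := by
    rw [hAdjoint_eq_iff hd]
    have h6 : Tᴴ * H = Dε * T' := by rw [← hT, mul_assoc, h1, mul_one]
    have h7 : H = T'ᴴ * (Dε * T') := by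
      rw [← h6, ← mul_assoc, ← conjTranspose_mul, h1, conjTranspose_one, one_mul]
    calc (T * N * T')ᴴ * H = T'ᴴ * (Nᴴ * (Tᴴ * H)) := by simp only [conjTranspose_mul, mul_assoc]
      _ = T'ᴴ * ((N * Dε) * T') := by rw [h6, hNH, mul_assoc]
      _ = T'ᴴ * (Dε * T') * (T * (Dσ * N) * T') := by
          rw [← hεN]
          simp only [mul_assoc, hT'T]
      _ = H * (T * (Dσ * N) * T') := by rw [← h7]
  have hmul : ∀ A B : Matrix n n K, (T * A * T') * (T * B * T') = T * (A * B) * T' := fun A B => by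
    simp only [mul_assoc, hT'T]
  have hsub : ∀ A : Matrix n n K, 1 - T * A * T' = T * (1 - A) * T' := fun A => by
    rw [mul_sub, sub_mul, mul_one, h1]
  have hPe : P = T * Dσ * T' := by rw [← hPT, mul_assoc, h1, mul_one]
  refine ⟨T * N * T', ⟨(isHNeutralInvolutory_iff hd).2 ⟨?_, ?_⟩, ?_⟩, ?_⟩
  · rw [hmul, hNN, mul_one, h1]
  · rw [hadj, hsub, hsub, hmul, hfixN, mul_zero, zero_mul]
  · have h8 : N * (Dσ * N) = Dσ * N * N := by rw [← mul_assoc, ← hσN]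
    rw [IsHNormal, hadj, hmul, hmul, h8]
  · rw [hadj, hmul, mul_assoc Dσ, hNN, mul_one, hPe]

end NeutralInvolutions

/-! ### Unitary times neutral involutory factorizations -/

section Factorization

variable {K : Type*} [RCLike K] {n : Type*} [Fintype n] [DecidableEq n]

open Matrix

/-- For `H`-normal `X`, the neutrality identities `(1 - X^[H]) (1 - X) = 0` of the involutions `X`
and `X^[H]` coincide. -/
theorem IsHNormalNeutralInvolutory.adjoint {H X : Matrix n n K} (hH : H.IsHermitian)
    (hd : IsUnit H.det) (hX : IsHNormalNeutralInvolutory H X) :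
    IsHNormalNeutralInvolutory H (hAdjoint H X) := by
  obtain ⟨hX1, hX2⟩ := hX
  obtain ⟨h1, h2⟩ := (isHNeutralInvolutory_iff hd).1 hX1
  unfold IsHNormal at hX2
  refine ⟨(isHNeutralInvolutory_iff hd).2 ⟨?_, ?_⟩, ?_⟩
  · rw [← hAdjoint_mul hd, h1, hAdjoint_one hd]
  · rw [hAdjoint_hAdjoint hH hd, ← h2]
    simp only [sub_mul, mul_sub, one_mul, mul_one, hX2]
    abel
  · rw [IsHNormal, hAdjoint_hAdjoint hH hd, hX2]

theorem IsHNormalNeutralInvolutory.unitary_conj {H X L : Matrix n n K} (hH : H.IsHermitian)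
    (hd : IsUnit H.det) (hX : IsHNormalNeutralInvolutory H X) (hL : IsHUnitary H L) :
    IsHNormalNeutralInvolutory H (L * X * hAdjoint H L) := by
  obtain ⟨hX1, hX2⟩ := hX
  obtain ⟨h1, h2⟩ := (isHNeutralInvolutory_iff hd).1 hX1
  obtain ⟨hL1, hL2⟩ := hL
  unfold IsHNormal at hX2
  have hadj : hAdjoint H (L * X * hAdjoint H L) =
      L * hAdjoint H X * hAdjoint H L := by
    rw [hAdjoint_mul hd, hAdjoint_mul hd, hAdjoint_hAdjoint hH hd, mul_assoc]
  have hmul : ∀ A B : Matrix n n K, (L * A * hAdjoint H L) * (L * B * hAdjoint H L) =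
      L * (A * B) * hAdjoint H L := fun A B => by
    calc _ = L * A * (hAdjoint H L * L) * B * hAdjoint H L := by simp only [mul_assoc]
      _ = _ := by rw [hL1, mul_one, mul_assoc L A]
  have hsub : ∀ A : Matrix n n K,
      1 - L * A * hAdjoint H L = L * (1 - A) * hAdjoint H L := fun A => by
    rw [mul_sub, sub_mul, mul_one, hL2]
  refine ⟨(isHNeutralInvolutory_iff hd).2 ⟨?_, ?_⟩, ?_⟩
  · rw [hmul, h1, mul_one, hL2]
  · rw [hadj, hsub, hsub, hmul, h2, mul_zero, zero_mul]
  · rw [IsHNormal, hadj, hmul, hmul, hX2]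

theorem IsHUnitary.mul {H L M : Matrix n n K} (hd : IsUnit H.det) (hL : IsHUnitary H L)
    (hM : IsHUnitary H M) : IsHUnitary H (L * M) := by
  obtain ⟨h1, h2⟩ := hL
  obtain ⟨h3, h4⟩ := hM
  constructor <;> rw [hAdjoint_mul hd]
  · rw [mul_assoc, ← mul_assoc _ L, h1, one_mul, h3]
  · rw [mul_assoc, ← mul_assoc M, h4, one_mul, h2]

/-- The matrix `X X^[H]` is unitary because it is an `H`-selfadjoint involution. -/
theorem IsHNormalNeutralInvolutory.isHUnitary_mul_hAdjoint {H X : Matrix n n K} (hH : H.IsHermitian)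
    (hd : IsUnit H.det) (hX : IsHNormalNeutralInvolutory H X) :
    IsHUnitary H (X * hAdjoint H X) := by
  have h1 := hX.1.1
  have h2 : X * hAdjoint H X = hAdjoint H X * X := hX.2
  have h3 : hAdjoint H X * hAdjoint H X = 1 := by
    rw [← hAdjoint_mul hd, h1, hAdjoint_one hd]
  have h4 : X * hAdjoint H X * (X * hAdjoint H X) = 1 := by
    nth_rw 1 [h2]
    rw [mul_assoc, ← mul_assoc X, h1, one_mul, h3]
  constructor <;> rw [hAdjoint_mul hd, hAdjoint_hAdjoint hH hd, h4]

/-- A factorization `L X` can be changed to `(L X X^[H]) X^[H]`. Both factors change, unless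
`L X` itself is unitary. -/
theorem exists_other_unitary_mul_neutral {H L X : Matrix n n K} (hH : H.IsHermitian)
    (hd : IsUnit H.det) (hL : IsHUnitary H L) (hX : IsHNormalNeutralInvolutory H X)
    (hne : ¬ IsHUnitary H (L * X)) :
    ∃ M Y, IsHUnitary H M ∧ IsHNormalNeutralInvolutory H Y ∧ M * Y = L * X ∧ M ≠ L ∧ Y ≠ X := by
  have h1 := hX.1.1
  have h2 : X * hAdjoint H X = hAdjoint H X * X := hX.2
  have h3 : hAdjoint H X * hAdjoint H X = 1 := by rw [← hAdjoint_mul hd, h1, hAdjoint_one hd]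
  have h4 : X * hAdjoint H X ≠ 1 := fun h => hne (hL.mul hd ⟨h2 ▸ h, h⟩)
  refine ⟨L * (X * hAdjoint H X), hAdjoint H X, hL.mul hd (hX.isHUnitary_mul_hAdjoint hH hd),
    hX.adjoint hH hd, ?_, fun h => h4 ?_, fun h => h4 ?_⟩
  · rw [mul_assoc, mul_assoc, h3, mul_one]
  · have := congrArg (hAdjoint H L * ·) h
    simpa only [← mul_assoc, hL.1, one_mul] using this
  · rw [h, h1]

/-- The version of `exists_other_unitary_mul_neutral` for the opposite order: `X L` is changed to
`X^[H] (X X^[H] L)`. -/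
theorem exists_other_neutral_mul_unitary {H L X : Matrix n n K} (hH : H.IsHermitian)
    (hd : IsUnit H.det) (hL : IsHUnitary H L) (hX : IsHNormalNeutralInvolutory H X)
    (hne : ¬ IsHUnitary H (X * L)) :
    ∃ M Y, IsHUnitary H M ∧ IsHNormalNeutralInvolutory H Y ∧ Y * M = X * L ∧ M ≠ L ∧ Y ≠ X := by
  have h1 := hX.1.1
  have h2 : X * hAdjoint H X = hAdjoint H X * X := hX.2
  have h3 : hAdjoint H X * hAdjoint H X = 1 := by rw [← hAdjoint_mul hd, h1, hAdjoint_one hd]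
  have h4 : X * hAdjoint H X ≠ 1 := fun h => hne (IsHUnitary.mul hd ⟨h2 ▸ h, h⟩ hL)
  refine ⟨X * hAdjoint H X * L, hAdjoint H X, (hX.isHUnitary_mul_hAdjoint hH hd).mul hd hL,
    hX.adjoint hH hd, ?_, fun h => h4 ?_, fun h => h4 ?_⟩
  · rw [h2, ← mul_assoc, ← mul_assoc, h3, one_mul]
  · have := congrArg (· * hAdjoint H L) h
    simpa only [mul_assoc, hL.2, mul_one] using this
  · rw [h, h1]

/-- If `X` is `H`-normal with `X^[H] X = W^[H] W` and this matrix is an involution, then `W X` is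
`H`-unitary. -/
theorem exists_unitary_mul_neutral {H W : Matrix n n K} (hH : H.IsHermitian) (hd : IsUnit H.det)
    (hW : hAdjoint H W * W * (hAdjoint H W * W) = 1) :
    ∃ L X, IsHUnitary H L ∧ IsHNormalNeutralInvolutory H X ∧ L * X = W := by
  obtain ⟨X, hX, hXP⟩ := exists_neutral_involution_of_hAdjoint_mul_self hH hd hW rfl
  have h1 := hX.1.1
  have h2 : X * hAdjoint H X = hAdjoint H X * X := hX.2
  have h3 : hAdjoint H (W * X) * (W * X) = 1 := by
    calc hAdjoint H (W * X) * (W * X) = hAdjoint H X * (hAdjoint H W * W) * X := by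
          rw [hAdjoint_mul hd]
          simp only [mul_assoc]
      _ = hAdjoint H X * X * (hAdjoint H X * X) := by
          rw [← hXP]
          nth_rw 1 [← h2]
          simp only [mul_assoc]
      _ = 1 := by rw [hXP, hW]
  exact ⟨W * X, X, ⟨h3, mul_eq_one_comm.1 h3⟩, hX, by rw [mul_assoc, h1, mul_one]⟩

end Factorization

/-! ### The factorization -/

theorem mainTheorem1 {K : Type*} [RCLike K] {n : Type*} [Fintype n] [DecidableEq n]
    (H : Matrix n n K) (hH : H.IsHermitian) (hHdet : IsUnit H.det)
    (F : Matrix n n K) (hFdet : IsUnit F.det) :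
    ∃ Sg Sg' S S' : Matrix n n K,
      IsMatrixSign (hAdjoint H F * F) Sg ∧
      IsMatrixSign (F * hAdjoint H F) Sg' ∧
      IsPrincipalSqrt (Sg * (hAdjoint H F * F)) S ∧
      IsPrincipalSqrt (Sg' * (F * hAdjoint H F)) S' ∧
      IsRPosDef S ∧ IsHSelfadjoint H S ∧ IsHSelfadjoint (H * Sg) S ∧
      IsRPosDef S' ∧ IsHSelfadjoint H S' ∧ IsHSelfadjoint (H * Sg') S' ∧
      (∃ L X L₁ X₁ X' L' X₁' L₁' : Matrix n n K,
        IsNormalFactorization H F S S' L X L₁ X₁ X' L' X₁' L₁') ∧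
      -- non-uniqueness: every factor other than `S` and `S'` can be changed
      (Sg ≠ 1 → ∀ L X L₁ X₁ X' L' X₁' L₁' : Matrix n n K,
        IsNormalFactorization H F S S' L X L₁ X₁ X' L' X₁' L₁' →
        ∃ M Y M₁ Y₁ Y' M' Y₁' M₁' : Matrix n n K,
          IsNormalFactorization H F S S' M Y M₁ Y₁ Y' M' Y₁' M₁' ∧
          M ≠ L ∧ Y ≠ X ∧ M₁ ≠ L₁ ∧ Y₁ ≠ X₁ ∧
          Y' ≠ X' ∧ M' ≠ L' ∧ Y₁' ≠ X₁' ∧ M₁' ≠ L₁') := by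
  set A := hAdjoint H F * F with hA
  set A' := F * hAdjoint H F with hA'
  have hF : IsUnit F := (Matrix.isUnit_iff_isUnit_det F).2 hFdet
  have hFA : F * A = A' * F := by rw [hA, hA', mul_assoc]
  have hAu : IsUnit A := by
    have h1 : IsUnit H := (Matrix.isUnit_iff_isUnit_det H).2 hHdet
    have h2 : IsUnit H⁻¹ := (Matrix.isUnit_nonsing_inv_iff).2 h1
    exact ((h2.mul hF.star).mul h1).mul hF
  have hAadj : hAdjoint H A = A := by rw [hA, hAdjoint_mul hHdet, hAdjoint_hAdjoint hH hHdet]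
  have hAadj' : hAdjoint H A' = A' := by rw [hA', hAdjoint_mul hHdet, hAdjoint_hAdjoint hH hHdet]
  obtain ⟨f, hf, hf0, hfA⟩ := exists_annihilating_polynomial hAu
  have hfA' : Polynomial.aeval A' f = 0 := by
    have := mul_aeval_eq_of_mul_eq hFA f
    rw [hfA, mul_zero] at this
    exact (hF.mul_left_eq_zero).1 this.symm
  obtain ⟨p, q, hpq⟩ := exists_polynomials_isMatrixSign_isPrincipalSqrt (K := K) (n := n) hf hf0
  obtain ⟨hSg, hSgSg, hS⟩ := hpq A hfA
  obtain ⟨hSg', hSgSg', hS'⟩ := hpq A' hfA'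
  have hFS := mul_aeval_eq_of_mul_eq hFA q
  have hself : ∀ B : Matrix n n K, hAdjoint H B = B →
      Polynomial.aeval B p * Polynomial.aeval B p = 1 →
      IsHSelfadjoint H (Polynomial.aeval B q) ∧
      IsHSelfadjoint (H * Polynomial.aeval B p) (Polynomial.aeval B q) := by
    intro B hB hpp
    have h1 : hAdjoint H (Polynomial.aeval B q) = Polynomial.aeval B q := by
      rw [hAdjoint_aeval hHdet, hB]
    refine ⟨h1, ?_⟩
    have hd : IsUnit (H * Polynomial.aeval B p).det := by
      rw [Matrix.det_mul]
      exact hHdet.mul ((Matrix.isUnit_iff_isUnit_det _).1 (IsUnit.of_mul_eq_one _ hpp))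
    rw [IsHSelfadjoint, hAdjoint_eq_iff hd, ← mul_assoc, (hAdjoint_eq_iff hHdet).1 h1, mul_assoc,
      mul_assoc, ← map_mul, ← map_mul, mul_comm]
  set Sg := Polynomial.aeval A p
  set Sg' := Polynomial.aeval A' p
  set S := Polynomial.aeval A q with hSdef
  set S' := Polynomial.aeval A' q
  have hSS : S * S = Sg * A := hS.2.2.1
  have hSgS : Sg * S = S * Sg := by
    rw [hSdef, ← map_mul, ← map_mul, mul_comm]
  have hSu : IsUnit S := by
    have h1 : IsUnit (S * S) := hSS ▸ (IsUnit.of_mul_eq_one _ hSgSg).mul hAu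
    rw [Matrix.isUnit_iff_isUnit_det, Matrix.det_mul] at h1
    exact (Matrix.isUnit_iff_isUnit_det S).2 (isUnit_of_mul_isUnit_left h1)
  -- `T` is the inverse of `S`; the common value of `L X`, `L₁ X₁`, `X' L'`, `X₁' L₁'` is `F T`.
  obtain ⟨T, hST, hTS⟩ := isUnit_iff_exists.1 hSu
  have hTadj : hAdjoint H T = T := by
    have h1 := congrArg (hAdjoint H) hST
    rw [hAdjoint_mul hHdet, (hself A hAadj hSgSg).1, hAdjoint_one hHdet] at h1
    calc hAdjoint H T = hAdjoint H T * (S * T) := by rw [hST, mul_one]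
      _ = T := by rw [← mul_assoc, h1, one_mul]
  have hWW : hAdjoint H (F * T) * (F * T) = Sg := by
    have hAe : A = S * Sg * S := by
      rw [← hSgS, mul_assoc, hSS, ← mul_assoc, hSgSg, one_mul]
    calc hAdjoint H (F * T) * (F * T) = T * A * T := by
          rw [hAdjoint_mul hHdet, hTadj, hA]
          simp only [mul_assoc]
      _ = (T * S) * Sg * (S * T) := by
          rw [hAe]
          simp only [mul_assoc]
      _ = Sg := by rw [hTS, hST, one_mul, mul_one]
  have hFW : F = F * T * S := by rw [mul_assoc, hTS, mul_one]
  have hFW' : F = S' * (F * T) := by rw [← mul_assoc, ← hFS, mul_assoc, hST, mul_one]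
  refine ⟨Sg, Sg', S, S', hSg, hSg', hS, hS', hS.2.1, (hself A hAadj hSgSg).1,
    (hself A hAadj hSgSg).2, hS'.2.1, (hself A' hAadj' hSgSg').1, (hself A' hAadj' hSgSg').2, ?_, ?_⟩
  · obtain ⟨L, X, hL, hX, hLX⟩ := exists_unitary_mul_neutral (W := F * T) hH hHdet
      (by rw [hWW, hSgSg])
    have hXL : L * X * hAdjoint H L * L = L * X := by rw [mul_assoc, hL.1, mul_one]
    have hX' := hX.unitary_conj hH hHdet hL
    exact ⟨L, X, L, X, L * X * hAdjoint H L, L, L * X * hAdjoint H L, L,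
      { eq_LXS := by rw [hLX]; exact hFW
        eq_SLX := by rw [mul_assoc, hLX]; exact hFW'
        eq_SXL := by rw [mul_assoc, hXL, hLX]; exact hFW'
        eq_XLS := by rw [hXL, hLX]; exact hFW
        unitary_L := hL
        unitary_L₁ := hL
        unitary_L' := hL
        unitary_L₁' := hL
        neutral_X := hX
        neutral_X₁ := hX
        neutral_X' := hX'
        neutral_X₁' := hX'
        eq_LX := rfl
        eq_LX' := hXL.symm
        eq_XL := rfl }⟩
  · intro hne L X L₁ X₁ X' L' X₁' L₁' h
    have hW : L * X = F * T := by
      calc L * X = L * X * S * T := by rw [mul_assoc _ S, hST, mul_one]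
        _ = F * T := by rw [← h.eq_LXS]
    have hnu : ¬ IsHUnitary H (F * T) := fun hu => hne (hWW.symm.trans hu.1)
    have hW₁ : L₁ * X₁ = F * T := h.eq_LX.symm.trans hW
    have hW' : X' * L' = F * T := h.eq_LX'.symm.trans hW₁
    have hW₁' : X₁' * L₁' = F * T := h.eq_XL.symm.trans hW'
    obtain ⟨M, Y, hM, hY, hMY, hML, hYX⟩ := exists_other_unitary_mul_neutral hH hHdet
      h.unitary_L h.neutral_X (hW ▸ hnu)
    obtain ⟨M₁, Y₁, hM₁, hY₁, hMY₁, hML₁, hYX₁⟩ := exists_other_unitary_mul_neutral hH hHdet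
      h.unitary_L₁ h.neutral_X₁ (hW₁ ▸ hnu)
    obtain ⟨M', Y', hM', hY', hYM', hML', hYX'⟩ := exists_other_neutral_mul_unitary hH hHdet
      h.unitary_L' h.neutral_X' (hW' ▸ hnu)
    obtain ⟨M₁', Y₁', hM₁', hY₁', hYM₁', hML₁', hYX₁'⟩ := exists_other_neutral_mul_unitary hH hHdet
      h.unitary_L₁' h.neutral_X₁' (hW₁' ▸ hnu)
    exact ⟨M, Y, M₁, Y₁, Y', M', Y₁', M₁',
      { eq_LXS := by rw [hMY]; exact h.eq_LXS
        eq_SLX := by rw [mul_assoc, hMY₁, ← mul_assoc]; exact h.eq_SLX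
        eq_SXL := by rw [mul_assoc, hYM', ← mul_assoc]; exact h.eq_SXL
        eq_XLS := by rw [hYM₁']; exact h.eq_XLS
        unitary_L := hM
        unitary_L₁ := hM₁
        unitary_L' := hM'
        unitary_L₁' := hM₁'
        neutral_X := hY
        neutral_X₁ := hY₁
        neutral_X' := hY'
        neutral_X₁' := hY₁'
        eq_LX := by rw [hMY, hMY₁]; exact h.eq_LX
        eq_LX' := by rw [hMY₁, hYM']; exact h.eq_LX'
        eq_XL := by rw [hYM', hYM₁']; exact h.eq_XL },
      hML, hYX, hML₁, hYX₁, hYX', hML', hYX₁', hML₁'⟩
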